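/- Let $M$ be a smooth (Hausdorff) manifold with a smooth linear connection $\nabla$, whose induced connection on $\mathrm{End}(TM)$ is denoted by the same symbol. Let $\pi:\mathcal Z^0\to M$ be the general twistor space of $M$, i.e. the bundle whose fibre over $x$ consists of all linear complex structures $p$ of $T_xM$, $p^2=-1$, regarded as a submanifold of the total space of $\mathrm{End}(TM)$. Let $\Phi$ be the tautological section $\Phi_p=p$ of $\pi^*\mathrm{End}(TM)$. For every $p\in\mathcal Z^0$ the tangent space splits as $$T_p\mathcal Z^0=\mathcal H^\nabla_p\oplus\mathcal V_p,\qquad \mathcal H^\nabla_p=\ker\big(\xi\mapsto(\pi^*\nabla)_\xi\Phi\big),\qquad \mathcal V_p=\ker d\pi_p ,$$ where $d\pi:\mathcal H^\nabla_p\to T_{\pi(p)}M$ is an isomorphism, and $\mathcal V_p$ is identified by $\xi\mapsto(\pi^*\nabla)_\xi\Phi$ with the space of endomorphisms $A$ of $T_{\pi(p)}M$ satisfying $Ap=-pA$. The Penrose almost complex structure $\mathcal J^\nabla$ on $\mathcal Z^0$ preserves this splitting, is $A\mapsto pA$ on $\mathcal V_p$, and corresponds to $p$ itself on $\mathcal H^\nabla_p\cong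 T_{\pi(p)}M$. For an almost complex structure $j$ on $M$, the almost complex structure $\mathcal J^j$ on $\mathcal Z^0$ is defined in the same way, except that on $\mathcal H^\nabla_p\cong T_{\pi(p)}M$ it corresponds to $j_{\pi(p)}$. Smooth almost complex structures on $M$ are viewed as smooth sections $M\to\mathcal Z^0$. Given an almost complex structure $j_2$ on $M$ and an almost complex structure $\mathcal J$ on $\mathcal Z^0$, a section $j_1:M\to\mathcal Z^0$ is called $(j_2,\mathcal J)$-holomorphic if $dj_1(j_2X)=\mathcal J\,dj_1(X)$ for all $X\in TM$. For almost complex structures $j,j_1$ on $M$, condition $A(j,j_1)$ means that $\nabla_ZW\in\mathfrak X^{+,j_1}$ for all $Z\in\mathfrak X^{+,j}$ and $W\in\mathfrak X^{+,j_1}$, where $\mathfrak X^{+,j}$ denotes the space of smooth complex vector fields $Z$ with $jZ=iZ$ (type $(1,0)$ for $j$), and $\nabla$ is extended complex-bilinearly. Let $j,j_1,j_2$ be smooth almost complex structures on $M$. Then: (a) $j_1$ is $(j_2,\mathcal J^j)$-holomorphic if and only if $j_2=j$ and $A(j,j_1)$ holds; (b) in particular, $j$ is $(j,\mathcal J^j)$-holomorphic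 if and only if $A(j,j)$ holds; (c) $j_1$ is $(j,\mathcal J^\nabla)$-holomorphic if and only if $j_1=j$ and $A(j,j)$ holds. -/

import Mathlib

open scoped Manifold ContDiff

noncomputable section

namespace Twistor

open Bundle Topology

/-! ### Pull-back of a linear connection along a map -/

section Pullback

variable {E : Type*} [NormedAddCommGroup E] [NormedSpace ℝ E]
  {H : Type*} [TopologicalSpace H] {I : ModelWithCorners ℝ E H}
  {M : Type*} [TopologicalSpace M] [ChartedSpace H M]
  {E' : Type*} [NormedAddCommGroup E'] [NormedSpace ℝ E']
  {H' : Type*} [TopologicalSpace H'] {I' : ModelWithCorners ℝ E' H'}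
  {N : Type*} [TopologicalSpace N] [ChartedSpace H' N]
  {F : Type*} [NormedAddCommGroup F] [NormedSpace ℝ F]
  {V : M → Type*} [TopologicalSpace (TotalSpace F V)]
  [∀ x, AddCommGroup (V x)] [∀ x, Module ℝ (V x)] [∀ x, TopologicalSpace (V x)]
  [∀ x, IsTopologicalAddGroup (V x)] [∀ x, ContinuousSMul ℝ (V x)]
  [FiberBundle F V] [VectorBundle ℝ F V]

/-- The pulled-back connection `f^*∇`: for a connection `∇` on `V → M`, a map `f : N → M` and a
section `σ` of `f^*V`, the linear map `ξ ↦ (f^*∇)_ξ σ` on the tangent space of `N` at `n`.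
In the local frame `e` of `V` given by the trivialization at `f n`, write `σ = ∑ σᵏ f^*e_k`; then
`(f^*∇)_ξ σ = ∑ dσᵏ(ξ) e_k + ∑ σᵏ(n) ∇_{df ξ} e_k`. Here `FiberBundle.extend F (σ n)` is the
local section of `V` with the constant components `σᵏ(n)`. -/
def pullbackDeriv (cov : CovariantDerivative I F V) (f : N → M) (σ : Π n, V (f n)) (n : N) :
    TangentSpace I' n →L[ℝ] V (f n) :=
  ((trivializationAt F V (f n)).symmL ℝ (f n)) ∘L
      (mfderiv I' 𝓘(ℝ, F)
        (fun n' ↦ (trivializationAt F V (f n) (TotalSpace.mk' F (f n') (σ n'))).2) n :)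
    + (cov (FiberBundle.extend F (σ n)) (f n)) ∘L (mfderiv I' I f n)

end Pullback

variable {E : Type*} [NormedAddCommGroup E] [NormedSpace ℝ E]
  {M : Type*} [TopologicalSpace M] [ChartedSpace E M]

variable (E M) in
/-- The bundle `End(TM)`. -/
abbrev EndBundle : M → Type _ :=
  fun x ↦ TangentSpace 𝓘(ℝ, E) x →L[ℝ] TangentSpace 𝓘(ℝ, E) x

/-- A linear connection on `M` (a covariant derivative on the tangent bundle). -/
abbrev LinearConnection (E : Type*) [NormedAddCommGroup E] [NormedSpace ℝ E]
    (M : Type*) [TopologicalSpace M] [ChartedSpace E M] [IsManifold 𝓘(ℝ, E) ∞ M] :=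
  CovariantDerivative 𝓘(ℝ, E) E (TangentSpace 𝓘(ℝ, E) : M → Type _)

variable [IsManifold 𝓘(ℝ, E) ∞ M]

variable (E M) in
/-- The total space of `End(TM)`, a manifold modelled on `E × End(E)`. -/
abbrev EndTotal := TotalSpace (E →L[ℝ] E) (EndBundle E M)


/-! ### The connection induced on `End(TM)` -/

section Endo

/-- The section `A` of `End(TM)` is differentiable at `x`. -/
abbrev EndDiffAt (A : Π x : M, EndBundle E M x) (x : M) : Prop :=
  MDifferentiableAt 𝓘(ℝ, E) (𝓘(ℝ, E).prod 𝓘(ℝ, E →L[ℝ] E))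
    (fun y ↦ (TotalSpace.mk' (E →L[ℝ] E) y (A y) : EndTotal E M)) x

/-- The expression `∇_X (A W) - A (∇_X W)` at the point `x`. -/
def endoAux (cov : LinearConnection E M) (A : Π x : M, EndBundle E M x) (x : M)
    (X W : Π x : M, TangentSpace 𝓘(ℝ, E) x) : TangentSpace 𝓘(ℝ, E) x :=
  cov (fun y ↦ A y (W y)) x (X x) - A x (cov W x (X x))

theorem endoAux_tensorial_left (cov : LinearConnection E M) (A : Π x : M, EndBundle E M x) (x : M)
    (W : Π x : M, TangentSpace 𝓘(ℝ, E) x) :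
    TensorialAt 𝓘(ℝ, E) E (endoAux cov A x · W) x where
  smul _ _ := by simp [endoAux, smul_sub]
  add _ _ := by simp [endoAux]; abel

theorem endoAux_tensorial_right (cov : LinearConnection E M) {A : Π x : M, EndBundle E M x} {x : M}
    (hA : EndDiffAt A x) (X : Π x : M, TangentSpace 𝓘(ℝ, E) x) :
    TensorialAt 𝓘(ℝ, E) E (endoAux cov A x X) x where
  smul {f W} hf hW := by
    have h1 : MDiffAt (T% (fun y ↦ A y (W y))) x := hA.clm_bundle_apply hW
    have h2 : (fun y ↦ A y ((f • W) y)) = f • (fun y ↦ A y (W y)) := by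
      ext y; simp
    simp only [endoAux]
    rw [h2, cov.isCovariantDerivativeOnUniv.leibniz h1 hf,
      cov.isCovariantDerivativeOnUniv.leibniz hW hf]
    simp [smul_sub]
  add {W W'} hW hW' := by
    have h1 : MDiffAt (T% (fun y ↦ A y (W y))) x := hA.clm_bundle_apply hW
    have h1' : MDiffAt (T% (fun y ↦ A y (W' y))) x := hA.clm_bundle_apply hW'
    have h2 : (fun y ↦ A y ((W + W') y)) = (fun y ↦ A y (W y)) + (fun y ↦ A y (W' y)) := by
      ext y; simp
    simp only [endoAux]
    rw [h2, cov.isCovariantDerivativeOnUniv.add h1 h1',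
      cov.isCovariantDerivativeOnUniv.add hW hW']
    simp
    abel

variable [FiniteDimensional ℝ E]

open scoped Classical in
/-- `v ↦ ∇_v A`, where `(∇_v A) W = ∇_v (A W) - A (∇_v W)` for every vector field `W`
(the right-hand side is tensorial in `W`). Junk value `0` if `A` is not differentiable at `x`. -/
def endoFun (cov : LinearConnection E M) (A : Π x : M, EndBundle E M x) (x : M) :
    TangentSpace 𝓘(ℝ, E) x →L[ℝ] EndBundle E M x :=
  if hA : EndDiffAt A x then
    TensorialAt.mkHom₂ (endoAux cov A x) x
      (fun W _ ↦ endoAux_tensorial_left cov A x W)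
      (fun X _ ↦ endoAux_tensorial_right cov hA X)
  else 0

theorem endoFun_apply (cov : LinearConnection E M) {A : Π x : M, EndBundle E M x} {x : M}
    (hA : EndDiffAt A x) (v w : TangentSpace 𝓘(ℝ, E) x) :
    endoFun cov A x v w =
      cov (fun y ↦ A y (FiberBundle.extend E w y)) x v
        - A x (cov (FiberBundle.extend E w) x v) := by
  simp only [endoFun, dif_pos hA, TensorialAt.mkHom₂_apply_eq_extend, endoAux,
    FiberBundle.extend_apply_self]

/-- The linear connection induced by `∇` on the bundle `End(TM)`. -/
def endoConnection (cov : LinearConnection E M) :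
    CovariantDerivative 𝓘(ℝ, E) (E →L[ℝ] E) (EndBundle E M) where
  toFun := endoFun cov
  isCovariantDerivativeOnUniv :=
    { add := by
        intro A B x hA hB _
        have hAB : EndDiffAt (A + B) x := mdifferentiableAt_add_section hA hB
        ext v w
        have hw := FiberBundle.mdifferentiableAt_extend (V := (TangentSpace 𝓘(ℝ, E) : M → Type _))
          𝓘(ℝ, E) E w
        have h2 : (fun y ↦ (A + B) y (FiberBundle.extend E w y))
          = (fun y ↦ A y (FiberBundle.extend E w y))
            + (fun y ↦ B y (FiberBundle.extend E w y)) := by ext y; simp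
        rw [endoFun_apply cov hAB]
        simp only [add_apply]
        rw [endoFun_apply cov hA, endoFun_apply cov hB, h2,
          cov.isCovariantDerivativeOnUniv.add (hA.clm_bundle_apply hw) (hB.clm_bundle_apply hw)]
        simp
        abel
      leibniz := by
        intro A g x hA hg _
        have hgA : EndDiffAt (g • A) x := hg.smul_section hA
        ext v w
        have hw := FiberBundle.mdifferentiableAt_extend (V := (TangentSpace 𝓘(ℝ, E) : M → Type _))
          𝓘(ℝ, E) E w
        have h2 : (fun y ↦ (g • A) y (FiberBundle.extend E w y))
          = g • (fun y ↦ A y (FiberBundle.extend E w y)) := by ext y; simp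
        rw [endoFun_apply cov hgA]
        simp only [add_apply, smul_apply,
          ContinuousLinearMap.smulRight_apply]
        rw [endoFun_apply cov hA, h2,
          cov.isCovariantDerivativeOnUniv.leibniz (hA.clm_bundle_apply hw) hg]
        simp [smul_sub]
        abel }

end Endo

/-! ### The general twistor space -/

variable (E M) in
/-- The general twistor space `𝒵⁰`: pairs `(x, J)` with `J` a linear complex structure of `T_xM`.
It is a submanifold of the total space of `End(TM)`. -/
abbrev TwistorSpace := {p : EndTotal E M // p.2 ∘L p.2 = -ContinuousLinearMap.id ℝ _}

/-- The endomorphism-component of the points of `End(TM)` near `p`, read in the local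
trivialization of `End(TM)` around the base point of `p`. It is compatible with composition. -/
def fibreCoord (p q : EndTotal E M) : E →L[ℝ] E :=
  (trivializationAt (E →L[ℝ] E) (EndBundle E M) p.1 q).2

/-- The tangent space of `𝒵⁰` at `p`, as a subspace of the tangent space of `End(TM)`:
near `p`, in a local trivialization, `𝒵⁰` is the submanifold `{J ∘ J = -1}`, and its
tangent space is the kernel of the differential of `J ↦ J ∘ J`. -/
def twistorTangent (p : TwistorSpace E M) :
    Submodule ℝ (TangentSpace (𝓘(ℝ, E).prod 𝓘(ℝ, E →L[ℝ] E)) p.1) :=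
  LinearMap.ker (mfderiv (𝓘(ℝ, E).prod 𝓘(ℝ, E →L[ℝ] E)) 𝓘(ℝ, E →L[ℝ] E)
    (fun q : EndTotal E M ↦ fibreCoord p.1 q ∘L fibreCoord p.1 q) p.1).toLinearMap

/-- The differential `dπ` of the bundle projection `π : End(TM) → M`. -/
def dproj (p : EndTotal E M) :
    TangentSpace (𝓘(ℝ, E).prod 𝓘(ℝ, E →L[ℝ] E)) p →L[ℝ] TangentSpace 𝓘(ℝ, E) p.1 :=
  mfderiv (𝓘(ℝ, E).prod 𝓘(ℝ, E →L[ℝ] E)) 𝓘(ℝ, E) (fun q : EndTotal E M ↦ q.1) p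

/-- The differential of the fibre coordinate. -/
def dcoord (p : EndTotal E M) :
    TangentSpace (𝓘(ℝ, E).prod 𝓘(ℝ, E →L[ℝ] E)) p →L[ℝ] (E →L[ℝ] E) :=
  mfderiv (𝓘(ℝ, E).prod 𝓘(ℝ, E →L[ℝ] E)) 𝓘(ℝ, E →L[ℝ] E) (fibreCoord p) p

theorem mdifferentiableAt_fibreCoord (p : EndTotal E M) :
    MDifferentiableAt (𝓘(ℝ, E).prod 𝓘(ℝ, E →L[ℝ] E)) 𝓘(ℝ, E →L[ℝ] E) (fibreCoord p) p :=
  ((mdifferentiableAt_totalSpace 𝓘(ℝ, E) (fun q : EndTotal E M ↦ q)).1 mdifferentiableAt_id).2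

theorem extChartAt_eq (p q : EndTotal E M)
    (hq : q ∈ (extChartAt (𝓘(ℝ, E).prod 𝓘(ℝ, E →L[ℝ] E)) p).source) :
    extChartAt (𝓘(ℝ, E).prod 𝓘(ℝ, E →L[ℝ] E)) p q
      = (extChartAt 𝓘(ℝ, E) p.1 q.1, fibreCoord p q) := by
  have hq' : q ∈ (trivializationAt (E →L[ℝ] E) (EndBundle E M) p.1).source := by
    rw [FiberBundle.extChartAt] at hq
    exact hq.1
  rw [FiberBundle.extChartAt]
  simp [fibreCoord, Trivialization.coe_fst _ hq']

theorem dproj_apply (p : EndTotal E M)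
    (ξ : TangentSpace (𝓘(ℝ, E).prod 𝓘(ℝ, E →L[ℝ] E)) p) : dproj p ξ = (ξ : E × (E →L[ℝ] E)).1 := by
  have h : HasMFDerivAt (𝓘(ℝ, E).prod 𝓘(ℝ, E →L[ℝ] E)) 𝓘(ℝ, E) (fun q : EndTotal E M ↦ q.1) p
      (ContinuousLinearMap.fst ℝ E (E →L[ℝ] E)) := by
    refine ⟨(mdifferentiableAt_proj (E := EndBundle E M) (IB := 𝓘(ℝ, E))).continuousAt, ?_⟩
    have he : writtenInExtChartAt (𝓘(ℝ, E).prod 𝓘(ℝ, E →L[ℝ] E)) 𝓘(ℝ, E) p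
        (fun q : EndTotal E M ↦ q.1) =ᶠ[𝓝[Set.range (𝓘(ℝ, E).prod 𝓘(ℝ, E →L[ℝ] E))]
          (extChartAt (𝓘(ℝ, E).prod 𝓘(ℝ, E →L[ℝ] E)) p p)]
        (ContinuousLinearMap.fst ℝ E (E →L[ℝ] E)) := by
      filter_upwards [extChartAt_target_mem_nhdsWithin p] with y hy
      have h := extChartAt_eq p _ ((extChartAt _ p).map_target hy)
      rw [(extChartAt _ p).right_inv hy] at h
      exact (congrArg Prod.fst h).symm
    exact HasFDerivWithinAt.congr_of_eventuallyEq
      (ContinuousLinearMap.fst ℝ E (E →L[ℝ] E)).hasFDerivWithinAt he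
      (he.eq_of_nhdsWithin (Set.mem_range_self _))
  exact congrArg (fun L ↦ L ξ) h.mfderiv

theorem dcoord_apply (p : EndTotal E M)
    (ξ : TangentSpace (𝓘(ℝ, E).prod 𝓘(ℝ, E →L[ℝ] E)) p) :
    dcoord p ξ = (ξ : E × (E →L[ℝ] E)).2 := by
  have h : HasMFDerivAt (𝓘(ℝ, E).prod 𝓘(ℝ, E →L[ℝ] E)) 𝓘(ℝ, E →L[ℝ] E) (fibreCoord p) p
      (ContinuousLinearMap.snd ℝ E (E →L[ℝ] E)) := by
    refine ⟨(mdifferentiableAt_fibreCoord p).continuousAt, ?_⟩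
    have he : writtenInExtChartAt (𝓘(ℝ, E).prod 𝓘(ℝ, E →L[ℝ] E)) 𝓘(ℝ, E →L[ℝ] E) p
        (fibreCoord p) =ᶠ[𝓝[Set.range (𝓘(ℝ, E).prod 𝓘(ℝ, E →L[ℝ] E))]
          (extChartAt (𝓘(ℝ, E).prod 𝓘(ℝ, E →L[ℝ] E)) p p)]
        (ContinuousLinearMap.snd ℝ E (E →L[ℝ] E)) := by
      filter_upwards [extChartAt_target_mem_nhdsWithin p] with y hy
      have h := extChartAt_eq p _ ((extChartAt _ p).map_target hy)
      rw [(extChartAt _ p).right_inv hy] at h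
      exact (congrArg Prod.snd h).symm
    exact HasFDerivWithinAt.congr_of_eventuallyEq
      (ContinuousLinearMap.snd ℝ E (E →L[ℝ] E)).hasFDerivWithinAt he
      (he.eq_of_nhdsWithin (Set.mem_range_self _))
  exact congrArg (fun L ↦ L ξ) h.mfderiv

theorem mem_twistorTangent_iff (p : TwistorSpace E M)
    (ξ : TangentSpace (𝓘(ℝ, E).prod 𝓘(ℝ, E →L[ℝ] E)) p.1) :
    ξ ∈ twistorTangent p ↔
      dcoord p.1 ξ ∘L fibreCoord p.1 p.1 + fibreCoord p.1 p.1 ∘L dcoord p.1 ξ = 0 := by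
  have h := (mdifferentiableAt_fibreCoord p.1).hasMFDerivAt
  have h2 := congrArg (fun L ↦ L ξ) (h.mul' h).mfderiv
  have h3 := h2.trans (add_comm _ _)
  exact (Eq.congr_left h3 : _ ↔ _)

theorem fibreCoord_eq (p q : EndTotal E M) :
    fibreCoord p q = ContinuousLinearMap.inCoordinates E (TangentSpace 𝓘(ℝ, E)) E
      (TangentSpace 𝓘(ℝ, E)) p.1 q.1 p.1 q.1 q.2 := by
  simp only [fibreCoord]
  exact congrArg Prod.snd (hom_trivializationAt_apply (RingHom.id ℝ) p.1 q)

theorem fibreCoord_comp (p : EndTotal E M) {x : M} (A B : EndBundle E M x)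
    (hx : x ∈ (trivializationAt E (TangentSpace 𝓘(ℝ, E) : M → Type _) p.1).baseSet) :
    fibreCoord p ⟨x, A ∘L B⟩ = fibreCoord p ⟨x, A⟩ ∘L fibreCoord p ⟨x, B⟩ := by
  rw [fibreCoord_eq, fibreCoord_eq, fibreCoord_eq]
  rw [ContinuousLinearMap.inCoordinates_eq hx hx, ContinuousLinearMap.inCoordinates_eq hx hx,
    ContinuousLinearMap.inCoordinates_eq hx hx]
  ext v
  simp only [ContinuousLinearMap.comp_apply, ContinuousLinearEquiv.coe_coe,
    ContinuousLinearEquiv.symm_apply_apply]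


theorem fibreCoord_injective (p : EndTotal E M) {x : M} {A B : EndBundle E M x}
    (hx : x ∈ (trivializationAt E (TangentSpace 𝓘(ℝ, E) : M → Type _) p.1).baseSet)
    (h : fibreCoord p ⟨x, A⟩ = fibreCoord p ⟨x, B⟩) : A = B := by
  rw [fibreCoord_eq, fibreCoord_eq, ContinuousLinearMap.inCoordinates_eq hx hx,
    ContinuousLinearMap.inCoordinates_eq hx hx] at h
  ext v
  have h2 := congrArg (fun L : E →L[ℝ] E ↦
    L ((trivializationAt E (TangentSpace 𝓘(ℝ, E) : M → Type _) p.1).continuousLinearEquivAt ℝ x hx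
      v)) h
  simp only [ContinuousLinearMap.comp_apply, ContinuousLinearEquiv.coe_coe,
    ContinuousLinearEquiv.symm_apply_apply, EmbeddingLike.apply_eq_iff_eq] at h2
  exact h2

theorem fibreCoord_neg_id (p : EndTotal E M) {x : M}
    (hx : x ∈ (trivializationAt E (TangentSpace 𝓘(ℝ, E) : M → Type _) p.1).baseSet) :
    fibreCoord p ⟨x, -ContinuousLinearMap.id ℝ (TangentSpace 𝓘(ℝ, E) x)⟩
      = -ContinuousLinearMap.id ℝ E := by
  rw [fibreCoord_eq, ContinuousLinearMap.inCoordinates_eq hx hx]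
  ext v
  simp only [ContinuousLinearMap.comp_apply, ContinuousLinearEquiv.coe_coe, neg_apply,
    ContinuousLinearMap.id_apply, map_neg, ContinuousLinearEquiv.apply_symm_apply]

theorem symmL_fibreCoord (p : EndTotal E M) :
    (trivializationAt (E →L[ℝ] E) (EndBundle E M) p.1).symmL ℝ p.1 (fibreCoord p p) = p.2 := by
  have hb : p.1 ∈ (trivializationAt (E →L[ℝ] E) (EndBundle E M) p.1).baseSet :=
    FiberBundle.mem_baseSet_trivializationAt' p.1
  have h := (trivializationAt (E →L[ℝ] E) (EndBundle E M) p.1).symmL_continuousLinearMapAt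
    (R := ℝ) hb p.2
  rw [Trivialization.continuousLinearMapAt_apply, Trivialization.linearMapAt_apply, if_pos hb] at h
  exact h

theorem fibreCoord_symmL (p : EndTotal E M) (A : E →L[ℝ] E) :
    fibreCoord p ⟨p.1, (trivializationAt (E →L[ℝ] E) (EndBundle E M) p.1).symmL ℝ p.1 A⟩ = A := by
  have hb : p.1 ∈ (trivializationAt (E →L[ℝ] E) (EndBundle E M) p.1).baseSet :=
    FiberBundle.mem_baseSet_trivializationAt' p.1
  have h := (trivializationAt (E →L[ℝ] E) (EndBundle E M) p.1).continuousLinearMapAt_symmL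
    (R := ℝ) hb A
  rw [Trivialization.continuousLinearMapAt_apply, Trivialization.linearMapAt_apply, if_pos hb] at h
  exact h

theorem symmL_injective (p : EndTotal E M) : Function.Injective
    ((trivializationAt (E →L[ℝ] E) (EndBundle E M) p.1).symmL ℝ p.1) := fun A B h ↦ by
  rw [← fibreCoord_symmL p A, ← fibreCoord_symmL p B]
  exact congrArg (fun C ↦ fibreCoord p ⟨p.1, C⟩) h

theorem symmL_eq_zero_iff (p : EndTotal E M) (A : E →L[ℝ] E) :
    (trivializationAt (E →L[ℝ] E) (EndBundle E M) p.1).symmL ℝ p.1 A = 0 ↔ A = 0 := by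
  constructor
  · intro h
    apply symmL_injective p
    rw [h, map_zero]
  · rintro rfl
    rw [map_zero]

theorem symmL_comp (p : EndTotal E M) (A B : E →L[ℝ] E) :
    (trivializationAt (E →L[ℝ] E) (EndBundle E M) p.1).symmL ℝ p.1 (A ∘L B)
      = (trivializationAt (E →L[ℝ] E) (EndBundle E M) p.1).symmL ℝ p.1 A
        ∘L (trivializationAt (E →L[ℝ] E) (EndBundle E M) p.1).symmL ℝ p.1 B := by
  apply fibreCoord_injective p (FiberBundle.mem_baseSet_trivializationAt' p.1)
  rw [fibreCoord_comp _ _ _ (FiberBundle.mem_baseSet_trivializationAt' p.1), fibreCoord_symmL,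
    fibreCoord_symmL, fibreCoord_symmL]

theorem extend_sq (p : TwistorSpace E M) : ∀ᶠ y in 𝓝 p.1.1,
    (FiberBundle.extend (E →L[ℝ] E) p.1.2 y : EndBundle E M y)
      ∘L (FiberBundle.extend (E →L[ℝ] E) p.1.2 y : EndBundle E M y)
      = -ContinuousLinearMap.id ℝ (TangentSpace 𝓘(ℝ, E) y) := by
  set t := trivializationAt E (TangentSpace 𝓘(ℝ, E) : M → Type _) p.1.1
  have ht : p.1.1 ∈ t.baseSet := FiberBundle.mem_baseSet_trivializationAt' p.1.1
  filter_upwards [t.open_baseSet.mem_nhds ht] with y hy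
  have hy' : y ∈ (trivializationAt (E →L[ℝ] E) (EndBundle E M) p.1.1).baseSet := ⟨hy, hy⟩
  have hc : fibreCoord p.1 ⟨y, FiberBundle.extend (E →L[ℝ] E) p.1.2 y⟩ = fibreCoord p.1 p.1 := by
    simp only [fibreCoord, FiberBundle.extend]
    rw [Trivialization.apply_mk_symm _ hy']
  apply fibreCoord_injective p.1 hy
  rw [fibreCoord_comp _ _ _ hy, hc, fibreCoord_neg_id _ hy]
  have h := fibreCoord_comp p.1 p.1.2 p.1.2 ht
  rw [p.2, fibreCoord_neg_id _ ht] at h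
  exact h.symm

theorem symmL_anticomm_iff (p : EndTotal E M) (A : E →L[ℝ] E) (B : EndBundle E M p.1)
    (hB : (trivializationAt (E →L[ℝ] E) (EndBundle E M) p.1).symmL ℝ p.1 A = B) :
    B ∘L p.2 + p.2 ∘L B = 0 ↔ A ∘L fibreCoord p p + fibreCoord p p ∘L A = 0 := by
  rw [← symmL_eq_zero_iff p, map_add, symmL_comp, symmL_comp, symmL_fibreCoord, hB]

/-! ### The Penrose splitting and the almost complex structures on `𝒵⁰` -/

section ACS

variable [FiniteDimensional ℝ E]

/-- `ξ ↦ (π^*∇)_ξ Φ`, where `Φ` is the tautological section `Φ_J = J` of `π^*End(TM)` and `∇` also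
denotes the induced connection on `End(TM)`. Its kernel is the horizontal distribution; on vertical
vectors it is the canonical identification with endomorphisms. -/
def connectionMap (cov : LinearConnection E M) (p : EndTotal E M) :
    TangentSpace (𝓘(ℝ, E).prod 𝓘(ℝ, E →L[ℝ] E)) p →L[ℝ] EndBundle E M p.1 :=
  pullbackDeriv (endoConnection cov) (fun q : EndTotal E M ↦ q.1) (fun q ↦ q.2) p

theorem connectionMap_apply (cov : LinearConnection E M) (p : EndTotal E M)
    (ξ : TangentSpace (𝓘(ℝ, E).prod 𝓘(ℝ, E →L[ℝ] E)) p) :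
    connectionMap cov p ξ
      = (trivializationAt (E →L[ℝ] E) (EndBundle E M) p.1).symmL ℝ p.1 (dcoord p ξ)
        + endoFun cov (FiberBundle.extend (E →L[ℝ] E) p.2) p.1 (dproj p ξ) := rfl

theorem endoFun_anticomm (cov : LinearConnection E M) {A : Π x : M, EndBundle E M x} {x : M}
    (hA : EndDiffAt A x)
    (hsq : ∀ᶠ y in 𝓝 x, A y ∘L A y = -ContinuousLinearMap.id ℝ (TangentSpace 𝓘(ℝ, E) y))
    (v : TangentSpace 𝓘(ℝ, E) x) :
    endoFun cov A x v ∘L A x = -(A x ∘L endoFun cov A x v) := by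
  ext w
  set W := FiberBundle.extend E w with hWdef
  have hW : MDiffAt (T% W) x :=
    FiberBundle.mdifferentiableAt_extend (V := (TangentSpace 𝓘(ℝ, E) : M → Type _)) 𝓘(ℝ, E) E w
  have hAW : MDiffAt (T% (fun y ↦ A y (W y))) x := hA.clm_bundle_apply hW
  have hAAW : MDiffAt (T% (fun y ↦ A y (A y (W y)))) x := hA.clm_bundle_apply hAW
  have hsq' : ∀ᶠ y in 𝓝 x, A y (A y (W y)) = (-W) y :=
    hsq.mono fun y hy ↦ congrArg (fun L ↦ L (W y)) hy
  have hval : ∀ U : Π y : M, TangentSpace 𝓘(ℝ, E) y, MDiffAt (T% U) x →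
      endoFun cov A x v (U x) = cov (fun y ↦ A y (U y)) x v - A x (cov U x v) := by
    intro U hU
    have hv : MDiffAt (T% (FiberBundle.extend E v)) x :=
      FiberBundle.mdifferentiableAt_extend (V := (TangentSpace 𝓘(ℝ, E) : M → Type _)) 𝓘(ℝ, E) E v
    have h := TensorialAt.mkHom₂_apply (Φ := endoAux cov A x)
      (fun W _ ↦ endoAux_tensorial_left cov A x W)
      (fun X _ ↦ endoAux_tensorial_right cov hA X) hv hU
    simp only [endoFun, dif_pos hA]
    simpa only [FiberBundle.extend_apply_self, endoAux] using h
  have hneg : MDiffAt (T% (-W)) x := mdifferentiableAt_neg_section hW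
  have hnegcov : cov (-W) x = -cov W x := by
    have h := cov.isCovariantDerivativeOnUniv.smul_const (-1 : ℝ) hW
    simpa using h
  have h1 : cov (fun y ↦ A y (A y (W y))) x = -cov W x := by
    rw [← hnegcov]
    exact cov.isCovariantDerivativeOnUniv.congr_of_eventuallyEq hAAW hneg Filter.univ_mem hsq'
  have hAx : ∀ u, A x (A x u) = -u := fun u ↦ congrArg (fun L ↦ L u) hsq.self_of_nhds
  have hWx : W x = w := FiberBundle.extend_apply_self E w
  have h2 := hval _ hAW
  have h3 := hval _ hW
  rw [hWx] at h2 h3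
  simp only [ContinuousLinearMap.comp_apply, neg_apply]
  rw [h2, h3, h1, map_sub, hAx]
  simp
  abel

/-- The fibre at `p` of the vertical bundle: the endomorphisms of `T_xM` anti-commuting with the
complex structure `p`. -/
def antiCommuting (p : TwistorSpace E M) : Submodule ℝ (EndBundle E M p.1.1) where
  carrier := {A | A ∘L p.1.2 = -(p.1.2 ∘L A)}
  zero_mem' := by simp
  add_mem' {A B} hA hB := by
    simp only [Set.mem_ofPred_eq] at hA hB ⊢
    rw [ContinuousLinearMap.add_comp, ContinuousLinearMap.comp_add, hA, hB, neg_add]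
  smul_mem' c A hA := by
    simp only [Set.mem_ofPred_eq] at hA ⊢
    rw [ContinuousLinearMap.smul_comp, ContinuousLinearMap.comp_smul, hA, smul_neg]

/-- The complex structure `A ↦ p A` on the fibre at `p` of the vertical bundle. -/
def leftMul (p : TwistorSpace E M) : antiCommuting p →ₗ[ℝ] antiCommuting p where
  toFun A := ⟨p.1.2 ∘L A.1, by
    have h : A.1 ∘L p.1.2 = -(p.1.2 ∘L A.1) := A.2
    change (p.1.2 ∘L A.1) ∘L p.1.2 = -(p.1.2 ∘L (p.1.2 ∘L A.1))
    rw [ContinuousLinearMap.comp_assoc, h, ContinuousLinearMap.comp_neg]⟩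
  map_add' A B := Subtype.ext (ContinuousLinearMap.comp_add _ _ _)
  map_smul' c A := Subtype.ext (ContinuousLinearMap.comp_smul _ _ _)

theorem mem_twistorTangent_iff_connectionMap (cov : LinearConnection E M) (p : TwistorSpace E M)
    (ξ : TangentSpace (𝓘(ℝ, E).prod 𝓘(ℝ, E →L[ℝ] E)) p.1) :
    ξ ∈ twistorTangent p ↔ connectionMap cov p.1 ξ ∈ antiCommuting p := by
  have hG := endoFun_anticomm cov
    (FiberBundle.mdifferentiableAt_extend (V := EndBundle E M) 𝓘(ℝ, E) (E →L[ℝ] E) p.1.2)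
    (extend_sq p) (dproj p.1 ξ)
  rw [FiberBundle.extend_apply_self] at hG
  rw [mem_twistorTangent_iff, ← symmL_anticomm_iff p.1 (dcoord p.1 ξ) _ rfl]
  change _ ↔ (connectionMap cov p.1 ξ) ∘L p.1.2 = -(p.1.2 ∘L connectionMap cov p.1 ξ)
  rw [connectionMap_apply, ContinuousLinearMap.add_comp, ContinuousLinearMap.comp_add, hG,
    neg_add, add_left_inj]
  exact add_eq_zero_iff_eq_neg

/-- The splitting `T_p𝒵⁰ = 𝓗^∇ ⊕ 𝓥 ≅ T_xM × 𝓥_p`, as the linear map `ξ ↦ (dπ ξ, (π^*∇)_ξ Φ)`. -/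
def splittingMap (cov : LinearConnection E M) (p : TwistorSpace E M) :
    twistorTangent p →ₗ[ℝ] TangentSpace 𝓘(ℝ, E) p.1.1 × antiCommuting p :=
  LinearMap.prod ((dproj p.1).toLinearMap ∘ₗ (twistorTangent p).subtype)
    (((connectionMap cov p.1).toLinearMap ∘ₗ (twistorTangent p).subtype).codRestrict
      (antiCommuting p) fun ξ ↦ (mem_twistorTangent_iff_connectionMap cov p ξ.1).1 ξ.2)

theorem splittingMap_bijective (cov : LinearConnection E M) (p : TwistorSpace E M) :
    Function.Bijective (splittingMap cov p) := by
  set e := (trivializationAt (E →L[ℝ] E) (EndBundle E M) p.1.1).symmL ℝ p.1.1 with he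
  have hinj : Function.Injective e := symmL_injective p.1
  constructor
  · intro ξ η h
    have h1 : dproj p.1 ξ.1 = dproj p.1 η.1 := congrArg Prod.fst h
    have h2 : connectionMap cov p.1 ξ.1 = connectionMap cov p.1 η.1 :=
      congrArg (fun t ↦ (Prod.snd t).1) h
    rw [connectionMap_apply, connectionMap_apply, h1, add_left_inj] at h2
    have h3 := hinj h2
    rw [dproj_apply, dproj_apply] at h1
    rw [dcoord_apply, dcoord_apply] at h3
    exact Subtype.ext (Prod.ext h1 h3)
  · rintro ⟨v, A⟩
    let B : EndBundle E M p.1.1 :=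
      A.1 - endoFun cov (FiberBundle.extend (E →L[ℝ] E) p.1.2) p.1.1 v
    let ξ : TangentSpace (𝓘(ℝ, E).prod 𝓘(ℝ, E →L[ℝ] E)) p.1 :=
      ((v, fibreCoord p.1 ⟨p.1.1, B⟩) : E × (E →L[ℝ] E))
    have hv : dproj p.1 ξ = v := dproj_apply p.1 ξ
    have hB : e (dcoord p.1 ξ) = B := by
      rw [dcoord_apply]
      exact symmL_fibreCoord ⟨p.1.1, B⟩
    have hK : connectionMap cov p.1 ξ = A.1 := by
      rw [connectionMap_apply, hv, ← he, hB]
      exact sub_add_cancel _ _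
    have hξ : ξ ∈ twistorTangent p := by
      rw [mem_twistorTangent_iff_connectionMap cov, hK]
      exact A.2
    exact ⟨⟨ξ, hξ⟩, Prod.ext hv (Subtype.ext hK)⟩

/-- The splitting as a linear isomorphism. -/
def splitting (cov : LinearConnection E M) (p : TwistorSpace E M) :
    twistorTangent p ≃ₗ[ℝ] TangentSpace 𝓘(ℝ, E) p.1.1 × antiCommuting p :=
  LinearEquiv.ofBijective _ (splittingMap_bijective cov p)

/-- The twistorial endomorphism field on `𝒵⁰`: it preserves the splitting `T𝒵⁰ = 𝓗^∇ ⊕ 𝓥`, is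
left multiplication `A ↦ p A` on the vertical part, and is `f p` on the horizontal part
`𝓗^∇_p ≅ T_xM` (identified by `dπ`). -/
def twistorACS (cov : LinearConnection E M)
    (f : (p : TwistorSpace E M) → EndBundle E M p.1.1) (p : TwistorSpace E M) :
    twistorTangent p →ₗ[ℝ] twistorTangent p :=
  (splitting cov p).symm.toLinearMap ∘ₗ
    (LinearMap.prodMap (f p).toLinearMap (leftMul p)) ∘ₗ (splitting cov p).toLinearMap

end ACS

/-! ### Almost complex structures as sections of `𝒵⁰` -/

variable (E M) in
/-- A smooth almost complex structure on `M`. -/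
@[ext]
structure AlmostComplexStructure where
  /-- The underlying smooth section of `End(TM)`. -/
  toSection : Cₛ^∞⟮𝓘(ℝ, E); E →L[ℝ] E, EndBundle E M⟯
  sq : ∀ x, toSection x ∘L toSection x = -ContinuousLinearMap.id ℝ (TangentSpace 𝓘(ℝ, E) x)

/-- An almost complex structure, viewed as a section `M → 𝒵⁰`. -/
def AlmostComplexStructure.toTwistor (j : AlmostComplexStructure E M) (x : M) :
    TwistorSpace E M :=
  ⟨⟨x, j.toSection x⟩, j.sq x⟩

theorem AlmostComplexStructure.mfderiv_mem (j : AlmostComplexStructure E M) (x : M)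
    (v : TangentSpace 𝓘(ℝ, E) x) :
    mfderiv 𝓘(ℝ, E) (𝓘(ℝ, E).prod 𝓘(ℝ, E →L[ℝ] E)) (fun y ↦ (j.toTwistor y).1) x v
      ∈ twistorTangent (j.toTwistor x) := by
  set t := trivializationAt E (TangentSpace 𝓘(ℝ, E) : M → Type _) x
  have ht : x ∈ t.baseSet := FiberBundle.mem_baseSet_trivializationAt' x
  set p : EndTotal E M := (j.toTwistor x).1 with hp
  have hs : MDifferentiableAt 𝓘(ℝ, E) (𝓘(ℝ, E).prod 𝓘(ℝ, E →L[ℝ] E))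
      (fun y ↦ (j.toTwistor y).1) x :=
    j.toSection.contMDiff.mdifferentiableAt (by simp)
  have hg : MDifferentiableAt (𝓘(ℝ, E).prod 𝓘(ℝ, E →L[ℝ] E)) 𝓘(ℝ, E →L[ℝ] E)
      (fun q : EndTotal E M ↦ fibreCoord p q ∘L fibreCoord p q) p :=
    (mdifferentiableAt_fibreCoord p).clm_comp (mdifferentiableAt_fibreCoord p)
  have hcomp := hg.hasMFDerivAt.comp x hs.hasMFDerivAt
  have hconst : HasMFDerivAt 𝓘(ℝ, E) 𝓘(ℝ, E →L[ℝ] E)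
      ((fun q : EndTotal E M ↦ fibreCoord p q ∘L fibreCoord p q) ∘ fun y ↦ (j.toTwistor y).1) x
      (0 : TangentSpace 𝓘(ℝ, E) x →L[ℝ] (E →L[ℝ] E)) := by
    refine (hasMFDerivAt_const (-ContinuousLinearMap.id ℝ E) x).congr_of_eventuallyEq ?_
    filter_upwards [t.open_baseSet.mem_nhds ht] with y hy
    have h := fibreCoord_comp p (j.toSection y) (j.toSection y) hy
    rw [j.sq, fibreCoord_neg_id p hy] at h
    exact h.symm
  exact congrArg (fun L ↦ L v) (hasMFDerivAt_unique hcomp hconst)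

/-- The differential `dj : T_xM → T_{j(x)}𝒵⁰` of the section `j : M → 𝒵⁰`. -/
def AlmostComplexStructure.differential (j : AlmostComplexStructure E M) (x : M) :
    TangentSpace 𝓘(ℝ, E) x →ₗ[ℝ] twistorTangent (j.toTwistor x) :=
  LinearMap.codRestrict _
    (mfderiv 𝓘(ℝ, E) (𝓘(ℝ, E).prod 𝓘(ℝ, E →L[ℝ] E)) (fun y ↦ (j.toTwistor y).1) x).toLinearMap
    (j.mfderiv_mem x)

/-- `j₁ : M → 𝒵⁰` is `(j₂, 𝒥)`-holomorphic: `dj₁ ∘ j₂ = 𝒥 ∘ dj₁`. -/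
def IsHolomorphic (j₁ j₂ : AlmostComplexStructure E M)
    (𝒥 : (p : TwistorSpace E M) → twistorTangent p →ₗ[ℝ] twistorTangent p) : Prop :=
  ∀ (x : M) (v : TangentSpace 𝓘(ℝ, E) x),
    j₁.differential x (j₂.toSection x v) = 𝒥 (j₁.toTwistor x) (j₁.differential x v)

section

variable [FiniteDimensional ℝ E]

/-- The Penrose almost complex structure `𝒥^∇` on `𝒵⁰`: its horizontal part at `p` is `p` itself. -/
def penroseACS (cov : LinearConnection E M) (p : TwistorSpace E M) :
    twistorTangent p →ₗ[ℝ] twistorTangent p :=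
  twistorACS cov (fun p ↦ p.1.2) p

/-- The almost complex structure `𝒥^j` on `𝒵⁰`: its horizontal part at `p` is the fixed `j`. -/
def fixedACS (cov : LinearConnection E M) (j : AlmostComplexStructure E M)
    (p : TwistorSpace E M) : twistorTangent p →ₗ[ℝ] twistorTangent p :=
  twistorACS cov (fun p ↦ j.toSection p.1.1) p

end

/-! ### Condition `A(j, j₁)` -/

variable (E M) in
/-- Smooth (real) vector fields. -/
abbrev SmoothVectorField := Cₛ^∞⟮𝓘(ℝ, E); E, (TangentSpace 𝓘(ℝ, E) : M → Type _)⟯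

variable (E M) in
/-- A smooth section `re + i im` of the complexified tangent bundle. -/
structure ComplexVectorField where
  /-- The real part. -/
  re : SmoothVectorField E M
  /-- The imaginary part. -/
  im : SmoothVectorField E M

/-- The complex vector field `Z` is of type `(1,0)` for `j`, i.e. `j Z = i Z` for the complex-linear
extension of `j`. -/
def ComplexVectorField.IsOneZero (Z : ComplexVectorField E M) (j : AlmostComplexStructure E M) :
    Prop :=
  ∀ x, j.toSection x (Z.re x) = -Z.im x ∧ j.toSection x (Z.im x) = Z.re x

/-- `∇_X Y` for smooth real vector fields and a smooth connection. -/
def covField (cov : LinearConnection E M) [hcov : cov.ContMDiffCovariantDerivative ∞]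
    (X Y : SmoothVectorField E M) : SmoothVectorField E M where
  toFun x := cov Y x (X x)
  contMDiff_toFun := by
    have h1 : ContMDiffOn 𝓘(ℝ, E) (𝓘(ℝ, E).prod 𝓘(ℝ, E)) (∞ + 1)
        (fun x ↦ TotalSpace.mk' E x (Y x)) Set.univ := Y.contMDiff.contMDiffOn
    have h2 := contMDiffOn_univ.1 (hcov.contMDiff.contMDiff h1)
    exact h2.clm_bundle_apply X.contMDiff

/-- `∇_Z W` for the complex-bilinear extension of a smooth connection to complex vector fields. -/
def complexCovField (cov : LinearConnection E M) [hcov : cov.ContMDiffCovariantDerivative ∞]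
    (Z W : ComplexVectorField E M) : ComplexVectorField E M where
  re := covField cov Z.re W.re - covField cov Z.im W.im
  im := covField cov Z.re W.im + covField cov Z.im W.re

/-- Condition `A(j, j₁)`: `∇_Z W` is of type `(1,0)` for `j₁` whenever `Z` is of type `(1,0)` for `j`
and `W` is of type `(1,0)` for `j₁`. -/
def ConditionA (cov : LinearConnection E M) [hcov : cov.ContMDiffCovariantDerivative ∞]
    (j j₁ : AlmostComplexStructure E M) : Prop :=
  ∀ Z W : ComplexVectorField E M, Z.IsOneZero j → W.IsOneZero j₁ →
    (complexCovField cov Z W).IsOneZero j₁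

end Twistor
end

/-!
An almost complex structure `j₁` is a section of `𝒵⁰`, and in the splitting
`T_p𝒵⁰ ≅ T_xM × {A | A p = -p A}` given by `ξ ↦ (dπ ξ, (π^*∇)_ξ Φ)` its differential is
`dj₁(v) = (v, ∇_v j₁)`: the horizontal part because `j₁` is a section, the vertical part because the
tautological section `Φ` pulls back along `j₁` to `j₁` itself
(`AlmostComplexStructure.connectionMap_differential`). The latter is read off from the expression of
a connection in a local trivialization (`cov_eq_flatDeriv_add`).

Since `𝒥^j` and `𝒥^∇` act diagonally in this splitting, holomorphicity of `j₁` splits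
(`isHolomorphic_twistorACS_iff`). The horizontal part says that `j₂` is the structure by which `𝒥`
acts on `𝓗^∇` along `j₁`, namely `j` for `𝒥^j` and `j₁` for `𝒥^∇`. The vertical part is the equation
`∇_{j₂ v} j₁ = j₁ ∘ ∇_v j₁`.

That equation, with `j` in place of `j₂`, is equivalent to `A(j, j₁)` (`conditionA_iff`). Indeed the
`(1,0)` fields are `Z = X - i j X` and `W = Y - i j₁ Y` with `X`, `Y` real, and expanding `∇_Z W`
shows that it is of type `(1,0)` for `j₁` exactly when `(∇_{jX} j₁) Y = j₁ (∇_X j₁) Y`. As real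
vector fields may be prescribed at a point (`exists_contMDiffSection_eq`), this for all `X`, `Y` is
the equation for all tangent vectors.
-/

noncomputable section

namespace Twistor

open Bundle Topology

/-! ### Local expression of a connection, and global sections with a prescribed value -/

section LocalExpression

variable {E : Type*} [NormedAddCommGroup E] [NormedSpace ℝ E]
  {H : Type*} [TopologicalSpace H] {I : ModelWithCorners ℝ E H}
  {M : Type*} [TopologicalSpace M] [ChartedSpace H M]
  {F : Type*} [NormedAddCommGroup F] [NormedSpace ℝ F]
  {V : M → Type*} [TopologicalSpace (TotalSpace F V)]
  [∀ x, AddCommGroup (V x)] [∀ x, Module ℝ (V x)] [∀ x, TopologicalSpace (V x)]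
  [FiberBundle F V] [VectorBundle ℝ F V]

variable (I F) in
/-- The differential at `x` of the coordinate expression of a section in the trivialization at `x`,
transported back to the fibre: the covariant derivative at `x` of the flat connection of that
trivialization. -/
def flatDeriv (σ : Π x, V x) (x : M) : TangentSpace I x →L[ℝ] V x :=
  ((trivializationAt F V x).symmL ℝ x) ∘L
    (mvfderiv I (fun y ↦ (trivializationAt F V x (TotalSpace.mk' F y (σ y))).2) x)

theorem flatDeriv_add [∀ x, IsTopologicalAddGroup (V x)] [ContMDiffVectorBundle 1 F V I]
    {σ τ : Π x, V x} {x : M} (hσ : MDiffAt (T% σ) x) (hτ : MDiffAt (T% τ) x) :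
    flatDeriv I F (σ + τ) x = flatDeriv I F σ x + flatDeriv I F τ x := by
  have hx := FiberBundle.mem_baseSet_trivializationAt' (F := F) (E := V) x
  have h : (fun y ↦ (trivializationAt F V x (TotalSpace.mk' F y ((σ + τ) y))).2) =ᶠ[𝓝 x]
      (fun y ↦ (trivializationAt F V x (TotalSpace.mk' F y (σ y))).2)
        + fun y ↦ (trivializationAt F V x (TotalSpace.mk' F y (τ y))).2 := by
    filter_upwards [(trivializationAt F V x).open_baseSet.mem_nhds hx] with y hy
    exact ((trivializationAt F V x).linear ℝ hy).map_add _ _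
  have h' := mvfderiv_add ((mdifferentiableAt_section _ _).1 hσ)
    ((mdifferentiableAt_section _ _).1 hτ)
  have h'' := Eq.trans h.mfderiv_eq h'
  simp only [flatDeriv, ← ContinuousLinearMap.comp_add]
  exact congrArg _ h''

theorem flatDeriv_smul [∀ x, IsTopologicalAddGroup (V x)] [∀ x, ContinuousSMul ℝ (V x)]
    [ContMDiffVectorBundle 1 F V I] {f : M → ℝ} {σ : Π x, V x} {x : M}
    (hf : MDiffAt f x) (hσ : MDiffAt (T% σ) x) :
    flatDeriv I F (f • σ) x = f x • flatDeriv I F σ x + (mvfderiv I f x).smulRight (σ x) := by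
  have hx := FiberBundle.mem_baseSet_trivializationAt' (F := F) (E := V) x
  have h : (fun y ↦ (trivializationAt F V x (TotalSpace.mk' F y ((f • σ) y))).2) =ᶠ[𝓝 x]
      f • fun y ↦ (trivializationAt F V x (TotalSpace.mk' F y (σ y))).2 := by
    filter_upwards [(trivializationAt F V x).open_baseSet.mem_nhds hx] with y hy
    exact ((trivializationAt F V x).linear ℝ hy).map_smul _ _
  have h' := mvfderiv_smul hf ((mdifferentiableAt_section _ _).1 hσ)
  have h'' := Eq.trans h.mfderiv_eq h'
  have hs : (trivializationAt F V x).symmL ℝ x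
      (trivializationAt F V x (TotalSpace.mk' F x (σ x))).2 = σ x := by
    simp [Trivialization.symmL_apply, hx]
  refine (congrArg (((trivializationAt F V x).symmL ℝ x) ∘L ·) h'').trans ?_
  ext v
  simp only [flatDeriv, ContinuousLinearMap.comp_apply, add_apply, smul_apply, map_add, map_smul,
    ContinuousLinearMap.smulRight_apply, hs]

theorem flatDeriv_extend {x : M} (u : V x) :
    flatDeriv I F (FiberBundle.extend F u) x = 0 := by
  have hx := FiberBundle.mem_baseSet_trivializationAt' (F := F) (E := V) x
  have h : (fun y ↦ (trivializationAt F V x (TotalSpace.mk' F y (FiberBundle.extend F u y))).2)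
      =ᶠ[𝓝 x] fun _ ↦ (trivializationAt F V x (TotalSpace.mk' F x u)).2 := by
    filter_upwards [(trivializationAt F V x).open_baseSet.mem_nhds hx] with y hy
    simp [FiberBundle.extend, hy]
  have h'' := h.mfderiv_eq (I := I) (I' := 𝓘(ℝ, F)) |>.trans mfderiv_const
  exact (congrArg (((trivializationAt F V x).symmL ℝ x) ∘L ·) h'').trans
    (ContinuousLinearMap.comp_zero _)

/-- The formula `∇_v σ = ∑ dσᵏ(v) e_k + ∑ σᵏ(x) ∇_v e_k` in the local frame of the trivialization
at `x`. After the flat connection is subtracted, `∇ σ` is tensorial in `σ`, so there `σ` may be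
replaced by the section with constant components. -/
theorem cov_eq_flatDeriv_add [∀ x, IsTopologicalAddGroup (V x)] [∀ x, ContinuousSMul ℝ (V x)]
    [FiniteDimensional ℝ F] [ContMDiffVectorBundle 1 F V I]
    (cov : CovariantDerivative I F V) {σ : Π x, V x} {x : M} (hσ : MDiffAt (T% σ) x) :
    cov σ x = flatDeriv I F σ x + cov (FiberBundle.extend F (σ x)) x := by
  have hT : TensorialAt I F (fun τ : Π x, V x ↦ cov τ x - flatDeriv I F τ x) x :=
    { smul := fun {f τ} hf hτ ↦ by
        rw [flatDeriv_smul hf hτ, cov.isCovariantDerivativeOnUniv.leibniz hτ hf, smul_sub]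
        abel
      add := fun {τ τ'} hτ hτ' ↦ by
        rw [flatDeriv_add hτ hτ', cov.isCovariantDerivativeOnUniv.add hτ hτ']
        abel }
  have h := hT.pointwise hσ (FiberBundle.mdifferentiableAt_extend I F (σ x))
    (FiberBundle.extend_apply_self F (σ x)).symm
  simp only [flatDeriv_extend, sub_zero] at h
  rw [← h]
  abel

/-- Over a Hausdorff manifold, every vector in a fibre of a smooth bundle is the value of a global
smooth section: a bump function cuts off the local section with constant components. -/
theorem exists_contMDiffSection_eq [FiniteDimensional ℝ E] [T2Space M] [IsManifold I ∞ M]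
    [ContMDiffVectorBundle ∞ F V I] {x : M} (u : V x) :
    ∃ σ : Cₛ^∞⟮I; F, V⟯, σ x = u := by
  obtain ⟨s, hs, hσ⟩ := FiberBundle.exists_contMDiffOn_extend (k := ∞) I F u
  obtain ⟨t, hts, ht, hxt⟩ := mem_nhds_iff.1 hs
  obtain ⟨f, -, hf⟩ := (SmoothBumpFunction.nhds_basis_tsupport (I := I) x).mem_iff.1
    (ht.mem_nhds hxt)
  refine ⟨⟨_, f.contMDiff.contMDiffOn.smul_section_of_tsupport ht hf (hσ.mono hts)⟩, ?_⟩
  simp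

end LocalExpression

variable {E : Type*} [NormedAddCommGroup E] [NormedSpace ℝ E]
  {M : Type*} [TopologicalSpace M] [ChartedSpace E M] [IsManifold 𝓘(ℝ, E) ∞ M]

/-! ### The `(1,0)` vector fields of an almost complex structure -/

theorem AlmostComplexStructure.sq_apply (j : AlmostComplexStructure E M) (x : M)
    (v : TangentSpace 𝓘(ℝ, E) x) : j.toSection x (j.toSection x v) = -v :=
  congrArg (fun L ↦ L v) (j.sq x)

/-- The smooth vector field `j X`. -/
def AlmostComplexStructure.mapField (j : AlmostComplexStructure E M) (X : SmoothVectorField E M) :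
    SmoothVectorField E M where
  toFun x := j.toSection x (X x)
  contMDiff_toFun := j.toSection.contMDiff.clm_bundle_apply X.contMDiff

/-- The `(1,0)` field `X - i j X`. -/
def AlmostComplexStructure.oneZeroField (j : AlmostComplexStructure E M)
    (X : SmoothVectorField E M) : ComplexVectorField E M :=
  ⟨X, -j.mapField X⟩

/-- Fields of type `(1,0)` are exactly the `X - i j X`, with `X` their real part. -/
theorem ComplexVectorField.isOneZero_iff (Z : ComplexVectorField E M)
    (j : AlmostComplexStructure E M) : Z.IsOneZero j ↔ Z = j.oneZeroField Z.re := by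
  obtain ⟨X, Y⟩ := Z
  constructor
  · intro h
    have hY : Y = -j.mapField X := ContMDiffSection.ext fun x ↦ by
      have h1 : j.toSection x (X x) = -Y x := (h x).1
      change Y x = -j.toSection x (X x)
      rw [h1, neg_neg]
    rw [hY]
    rfl
  · intro h x
    rw [h]
    refine ⟨(neg_neg _).symm, ?_⟩
    change j.toSection x (-j.toSection x (X x)) = X x
    rw [map_neg, j.sq_apply, neg_neg]

/-! ### The differential of an almost complex structure in the Penrose splitting -/

theorem AlmostComplexStructure.eq_iff (j j' : AlmostComplexStructure E M) :
    j = j' ↔ ∀ x v, j.toSection x v = j'.toSection x v :=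
  ⟨fun h _ _ ↦ by rw [h], fun h ↦ AlmostComplexStructure.ext
    (ContMDiffSection.ext fun x ↦ ContinuousLinearMap.ext (h x))⟩

theorem AlmostComplexStructure.endDiffAt (j : AlmostComplexStructure E M) (x : M) :
    EndDiffAt j.toSection x :=
  j.toSection.mdifferentiableAt

theorem AlmostComplexStructure.dproj_differential (j : AlmostComplexStructure E M) (x : M)
    (v : TangentSpace 𝓘(ℝ, E) x) : dproj (j.toTwistor x).1 (j.differential x v).1 = v := by
  have h := mfderiv_comp_apply x
    (mdifferentiableAt_proj (E := EndBundle E M) (IB := 𝓘(ℝ, E)) (p := (j.toTwistor x).1))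
    (j.endDiffAt x) v
  refine h.symm.trans ?_
  exact congrArg (fun L ↦ L v) (mfderiv_id (I := 𝓘(ℝ, E)) (x := x))

variable [FiniteDimensional ℝ E]

/-- Pulling the tautological section of `π^*End(TM)` back along `j` gives `j` itself, so the
vertical part of `dj(v)` is `∇_v j`. -/
theorem AlmostComplexStructure.connectionMap_differential (cov : LinearConnection E M)
    (j : AlmostComplexStructure E M) (x : M) (v : TangentSpace 𝓘(ℝ, E) x) :
    connectionMap cov (j.toTwistor x).1 (j.differential x v).1 = endoFun cov j.toSection x v := by
  have h := mfderiv_comp_apply x (mdifferentiableAt_fibreCoord (j.toTwistor x).1)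
    (j.endDiffAt x) v
  have h' := congrArg (fun L ↦ L v) (cov_eq_flatDeriv_add (endoConnection cov) (j.endDiffAt x))
  -- Both sides are a flat derivative in the trivialization plus `∇` of the section with constant
  -- components; `h` identifies the flat derivatives by the chain rule for `fibreCoord ∘ j`.
  refine (connectionMap_apply cov _ _).trans ?_
  rw [j.dproj_differential]
  refine Eq.trans ?_ h'.symm
  exact congrArg (fun B ↦ (trivializationAt (E →L[ℝ] E) (EndBundle E M) x).symmL ℝ x B
    + endoFun cov (FiberBundle.extend (E →L[ℝ] E) (j.toSection x)) x v) h.symm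

/-- The equation `ξ = 𝒥 η` in `T_p𝒵⁰`, read in the splitting, where `𝒥` is diagonal. -/
theorem eq_twistorACS_apply_iff (cov : LinearConnection E M)
    (f : (p : TwistorSpace E M) → EndBundle E M p.1.1) (p : TwistorSpace E M)
    (ξ η : twistorTangent p) :
    ξ = twistorACS cov f p η ↔
      dproj p.1 ξ.1 = f p (dproj p.1 η.1) ∧
        connectionMap cov p.1 ξ.1 = p.1.2 ∘L connectionMap cov p.1 η.1 :=
  ((splitting cov p).eq_symm_apply (y := ξ)).trans <|
    Prod.ext_iff.trans (and_congr Iff.rfl Subtype.ext_iff)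

/-- In the splitting `T𝒵⁰ = 𝓗^∇ ⊕ 𝓥`, holomorphicity of `j₁` separates into a horizontal condition
on `j₂` and the vertical equation `∇_{j₂ v} j₁ = j₁ ∘ ∇_v j₁`. -/
theorem isHolomorphic_twistorACS_iff (cov : LinearConnection E M)
    {f : (p : TwistorSpace E M) → EndBundle E M p.1.1} {j₁ j₂ j₃ : AlmostComplexStructure E M}
    (hf : ∀ x, f (j₁.toTwistor x) = j₃.toSection x) :
    IsHolomorphic j₁ j₂ (twistorACS cov f) ↔
      j₂ = j₃ ∧ ∀ x v, endoFun cov j₁.toSection x (j₂.toSection x v)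
        = j₁.toSection x ∘L endoFun cov j₁.toSection x v := by
  rw [AlmostComplexStructure.eq_iff]
  simp only [IsHolomorphic, ← forall_and]
  refine forall_congr' fun x ↦ forall_congr' fun v ↦
    (eq_twistorACS_apply_iff cov f (j₁.toTwistor x) _ _).trans ?_
  rw [hf, j₁.dproj_differential, j₁.dproj_differential, j₁.connectionMap_differential,
    j₁.connectionMap_differential]
  rfl

/-! ### Condition `A(j, j₁)` as an equation for `∇j₁` -/

/-- `(∇_v A) W = ∇_v (A W) - A (∇_v W)` for an arbitrary vector field `W`; the definition uses the
one with constant components in the local trivialization. -/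
theorem endoFun_apply_section (cov : LinearConnection E M) {A : Π x : M, EndBundle E M x} {x : M}
    (hA : EndDiffAt A x) (v : TangentSpace 𝓘(ℝ, E) x) {W : Π x : M, TangentSpace 𝓘(ℝ, E) x}
    (hW : MDiffAt (T% W) x) :
    endoFun cov A x v (W x) = cov (fun y ↦ A y (W y)) x v - A x (cov W x v) := by
  rw [endoFun_apply cov hA]
  have h := (endoAux_tensorial_right cov hA (FiberBundle.extend E v)).pointwise hW
    (FiberBundle.mdifferentiableAt_extend (V := (TangentSpace 𝓘(ℝ, E) : M → Type _))
      𝓘(ℝ, E) E (W x)) (FiberBundle.extend_apply_self E (W x)).symm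
  simpa only [endoAux, FiberBundle.extend_apply_self] using h.symm

variable (cov : LinearConnection E M) [cov.ContMDiffCovariantDerivative ∞]

/-- For `Z = X - i j X` and `W = Y - i j₁ Y`, the field `∇_Z W` is of type `(1,0)` for `j₁` exactly
when `(∇_{jX} j₁) Y = j₁ (∇_X j₁) Y`. -/
theorem complexCovField_isOneZero_iff (j j₁ : AlmostComplexStructure E M)
    (X Y : SmoothVectorField E M) :
    (complexCovField cov (j.oneZeroField X) (j₁.oneZeroField Y)).IsOneZero j₁ ↔
      ∀ x, endoFun cov j₁.toSection x (j.toSection x (X x)) (Y x)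
        = j₁.toSection x (endoFun cov j₁.toSection x (X x) (Y x)) := by
  refine forall_congr' fun x ↦ ?_
  have hneg : cov (-j₁.mapField Y : SmoothVectorField E M) x = -cov (j₁.mapField Y) x := by
    have h := cov.isCovariantDerivativeOnUniv.smul_const (-1 : ℝ)
      (j₁.mapField Y).mdifferentiableAt (x := x)
    rw [neg_one_smul, neg_one_smul] at h
    exact h
  have hend (v : TangentSpace 𝓘(ℝ, E) x) : endoFun cov j₁.toSection x v (Y x)
      = cov (j₁.mapField Y) x v - j₁.toSection x (cov Y x v) :=
    endoFun_apply_section cov (j₁.endDiffAt x) v Y.mdifferentiableAt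
  have hre : (complexCovField cov (j.oneZeroField X) (j₁.oneZeroField Y)).re x
      = cov Y x (X x) - cov (j₁.mapField Y) x (j.toSection x (X x)) := by
    change cov Y x (X x) - cov (-j₁.mapField Y : SmoothVectorField E M) x
      (-j.toSection x (X x)) = _
    rw [hneg, neg_apply, map_neg, neg_neg]
  have him : (complexCovField cov (j.oneZeroField X) (j₁.oneZeroField Y)).im x
      = -cov (j₁.mapField Y) x (X x) - cov Y x (j.toSection x (X x)) := by
    change cov (-j₁.mapField Y : SmoothVectorField E M) x (X x)
      + cov Y x (-j.toSection x (X x)) = _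
    rw [hneg, neg_apply, map_neg, sub_eq_add_neg]
  rw [hre, him, hend, hend]
  generalize cov Y x (X x) = a, cov (j₁.mapField Y) x (j.toSection x (X x)) = b,
    cov (j₁.mapField Y) x (X x) = c, cov Y x (j.toSection x (X x)) = d
  have key : b - j₁.toSection x d = j₁.toSection x (c - j₁.toSection x a) ↔
      j₁.toSection x (-c - d) = a - b := by
    simp only [map_sub, map_neg, j₁.sq_apply]
    constructor <;> intro h <;> linear_combination (norm := module) h
  rw [key]
  -- The other half of the type `(1,0)` condition follows by applying `j₁`.
  refine ⟨And.right, fun h ↦ ⟨?_, h⟩⟩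
  rw [← h, j₁.sq_apply]

theorem conditionA_iff [T2Space M] (j j₁ : AlmostComplexStructure E M) :
    ConditionA cov j j₁ ↔ ∀ x v, endoFun cov j₁.toSection x (j.toSection x v)
        = j₁.toSection x ∘L endoFun cov j₁.toSection x v := by
  constructor
  · intro h x v
    ext w
    obtain ⟨X, rfl⟩ := exists_contMDiffSection_eq (I := 𝓘(ℝ, E)) (F := E) v
    obtain ⟨Y, rfl⟩ := exists_contMDiffSection_eq (I := 𝓘(ℝ, E)) (F := E) w
    exact (complexCovField_isOneZero_iff cov j j₁ X Y).1
      (h _ _ ((ComplexVectorField.isOneZero_iff _ j).2 rfl)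
        ((ComplexVectorField.isOneZero_iff _ j₁).2 rfl)) x
  · intro h Z W hZ hW
    rw [(Z.isOneZero_iff j).1 hZ, (W.isOneZero_iff j₁).1 hW, complexCovField_isOneZero_iff]
    exact fun x ↦ congrArg (fun L ↦ L (W.re x)) (h x (Z.re x))

end Twistor

end

theorem mainTheorem2
    {E : Type*} [NormedAddCommGroup E] [NormedSpace ℝ E] [FiniteDimensional ℝ E]
    {M : Type*} [TopologicalSpace M] [T2Space M] [ChartedSpace E M] [IsManifold 𝓘(ℝ, E) ∞ M]
    (cov : Twistor.LinearConnection E M) [cov.ContMDiffCovariantDerivative ∞]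
    (j j₁ j₂ : Twistor.AlmostComplexStructure E M) :
    (Twistor.IsHolomorphic j₁ j₂ (Twistor.fixedACS cov j) ↔
      j₂ = j ∧ Twistor.ConditionA cov j j₁) ∧
    (Twistor.IsHolomorphic j j (Twistor.fixedACS cov j) ↔ Twistor.ConditionA cov j j) ∧
    (Twistor.IsHolomorphic j₁ j (Twistor.penroseACS cov) ↔
      j₁ = j ∧ Twistor.ConditionA cov j j) := by
  have key (j j₁ j₂ : Twistor.AlmostComplexStructure E M) :
      Twistor.IsHolomorphic j₁ j₂ (Twistor.fixedACS cov j) ↔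
        j₂ = j ∧ Twistor.ConditionA cov j j₁ := by
    refine (Twistor.isHolomorphic_twistorACS_iff cov fun _ ↦ rfl).trans (and_congr_right ?_)
    rintro rfl
    exact (Twistor.conditionA_iff cov j₂ j₁).symm
  refine ⟨key j j₁ j₂, (key j j j).trans (and_iff_right rfl), ?_⟩
  refine (Twistor.isHolomorphic_twistorACS_iff cov (j₃ := j₁) fun _ ↦ rfl).trans ?_
  rw [eq_comm (a := j)]
  refine and_congr_right ?_
  rintro rfl
  exact (Twistor.conditionA_iff cov j₁ j₁).symm
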